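/- Let $k\ge 0$ be an integer and let $G$ be a finite simple $(a,b)$-biregular bipartite graph with at least one vertex; that is, $V(G)$ is the disjoint union of two sets $X$ and $Y$, every edge of $G$ joins a vertex of $X$ to a vertex of $Y$, every vertex of $X$ has degree $a$, and every vertex of $Y$ has degree $b$. Let $\lambda_2$ denote the second largest eigenvalue, counted with multiplicity, of the adjacency matrix of $G$. Suppose that $a\ge 2k$ and $b\ge 2k$. If $$\lambda_2\le \sqrt{ab}-\frac{k}{\sqrt{\left\lceil\frac{a+1}{2}\right\rceil\left\lceil\frac{b+1}{2}\right\rceil}},$$ then $G$ contains $k$ pairwise edge-disjoint spanning trees. -/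

import Mathlib

/-- The adjacency matrix of a finite simple graph, with real entries, is Hermitian. -/
theorem SimpleGraph.adjMatrix_real_isHermitian {V : Type*} [Fintype V] [DecidableEq V]
    (G : SimpleGraph V) [DecidableRel G.Adj] : (G.adjMatrix ℝ).IsHermitian := by
  rw [Matrix.IsHermitian, Matrix.conjTranspose_eq_transpose_of_trivial]
  exact G.isSymm_adjMatrix

/-- The second largest eigenvalue (counted with multiplicity) of the adjacency matrix of a finite
simple graph. `Matrix.IsHermitian.eigenvalues₀` lists the eigenvalues in decreasing order, starting
with index `0`. For a graph with at most one vertex there is no second eigenvalue, and the value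
is set to `0`. -/
noncomputable def SimpleGraph.secondEigenvalue {V : Type*} [Fintype V] [DecidableEq V]
    (G : SimpleGraph V) [DecidableRel G.Adj] : ℝ :=
  if h : 1 < Fintype.card V then G.adjMatrix_real_isHermitian.eigenvalues₀ ⟨1, h⟩ else 0

/-- `G` is an `(a, b)`-biregular bipartite graph with bipartition `(X, Y)`: the sets `X` and `Y`
partition the vertex set, every edge joins `X` to `Y`, each vertex in `X` has degree `a` and
each vertex in `Y` has degree `b`. -/
structure SimpleGraph.IsBiregularBipartite {V : Type*} [Fintype V]
    (G : SimpleGraph V) [DecidableRel G.Adj] (X Y : Set V) (a b : ℕ) : Prop where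
  isBipartiteWith : G.IsBipartiteWith X Y
  union_eq_univ : X ∪ Y = Set.univ
  degree_left : ∀ v ∈ X, G.degree v = a
  degree_right : ∀ v ∈ Y, G.degree v = b

/-- `G` contains `k` pairwise edge-disjoint spanning trees. A graph `T i` on the same vertex
type `V` with `T i ≤ G` is a spanning subgraph of `G`. -/
def SimpleGraph.HasEdgeDisjointSpanningTrees {V : Type*} (G : SimpleGraph V) (k : ℕ) : Prop :=
  ∃ T : Fin k → SimpleGraph V,
    (∀ i, T i ≤ G ∧ (T i).IsTree) ∧
      ∀ i j, i ≠ j → Disjoint (T i).edgeSet (T j).edgeSet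

-- By the Nash-Williams–Tutte theorem it suffices that at least `k (t - 1)` edges cross every
-- partition into `t` nonempty parts.
--
-- That theorem is proved by exchanges in a forest packing `T` with the most edges. Let `S` consist
-- of all edges that exchanges can make unused. Each `T i ⊓ S` has the same components as `S`. Every
-- edge crossing the partition into these components lies in some `T i \ S`. Counting edges of
-- forests then forces each `T i` to be connected (`reachable_inf_exchangeClosure_iff`,
-- `hasEdgeDisjointSpanningTrees_of_partition`).
--
-- For the spectral part, write `∂p` for the number of edges leaving part `p`; it must be shown that
-- `∑ (2k - ∂p) ≤ 2k`. A part with `∂p < 2k` has more than `b / 2` left and `a / 2` right vertices,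
-- hence large volume (`le_volume`). For two such parts, testing `λ₂` on the span of their
-- square-root-degree vectors gives `(2k - ∂p)(2k - ∂q) ≤ e(p, q)²` (`mul_le_edgeWeight_sq`). Taking
-- `p` with `∂p` least yields `2k - ∂q ≤ e(p, q)` for all other `q`, and these `e(p, q)` sum to `∂p`
-- (`sum_sub_boundary_le`).

universe u

/-! ### Reachability and edge counts in forests -/

namespace SimpleGraph

variable {V : Type*}

/-- If all edges of `K` join vertices connected in `K'`, then so does every walk of `K`. -/
theorem Reachable.of_forall_adj {K K' : SimpleGraph V}
    (h : ∀ x y, K.Adj x y → K'.Reachable x y) {x y : V} (hxy : K.Reachable x y) :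
    K'.Reachable x y := by
  obtain ⟨p⟩ := hxy
  induction p with
  | nil => exact Reachable.refl _
  | cons hadj _ ih => exact (h _ _ hadj).trans ih

/-- A connection that cannot avoid `uv` splits into two pieces that do; these pieces later reroute
around a deleted edge. -/
theorem Reachable.deleteEdges_cases {K : SimpleGraph V} {u v x y : V} (h : K.Reachable x y) :
    (K.deleteEdges {s(u, v)}).Reachable x y ∨
      ((K.deleteEdges {s(u, v)}).Reachable x u ∧ (K.deleteEdges {s(u, v)}).Reachable v y) ∨
      ((K.deleteEdges {s(u, v)}).Reachable x v ∧ (K.deleteEdges {s(u, v)}).Reachable u y) := by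
  obtain ⟨p⟩ := h
  induction p with
  | nil => exact Or.inl (Reachable.refl _)
  | @cons a b c hadj _ ih =>
    by_cases he : s(a, b) = s(u, v)
    · rcases Sym2.eq_iff.mp he with ⟨rfl, rfl⟩ | ⟨rfl, rfl⟩
      · rcases ih with h | h | h
        · exact Or.inr (Or.inl ⟨Reachable.refl _, h⟩)
        · exact Or.inr (Or.inl ⟨Reachable.refl _, h.2⟩)
        · exact Or.inl h.2
      · rcases ih with h | h | h
        · exact Or.inr (Or.inr ⟨Reachable.refl _, h⟩)
        · exact Or.inl h.2
        · exact Or.inr (Or.inr ⟨Reachable.refl _, h.2⟩)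
    · have hab : (K.deleteEdges {s(u, v)}).Reachable a b :=
        Adj.reachable (by rw [deleteEdges_adj]; exact ⟨hadj, he⟩)
      rcases ih with h | h | h
      · exact Or.inl (hab.trans h)
      · exact Or.inr (Or.inl ⟨hab.trans h.1, h.2⟩)
      · exact Or.inr (Or.inr ⟨hab.trans h.1, h.2⟩)

/-- In a forest, deleting an edge of a path disconnects its ends. -/
theorem IsAcyclic.not_reachable_deleteEdges {F : SimpleGraph V} (hF : F.IsAcyclic) {x y : V}
    {p : F.Walk x y} (hp : p.IsPath) {e : Sym2 V} (he : e ∈ p.edges) :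
    ¬ (F.deleteEdges {e}).Reachable x y := by
  classical
  induction e with
  | _ u v =>
  rw [reachable_deleteEdges_iff_exists_walk]
  rintro ⟨q, hq⟩
  have : q.toPath = ⟨p, hp⟩ := (hF.subsingleton_path _ _).elim _ _
  apply hq
  apply Walk.edges_toPath_subset_edges q
  rw [this]
  exact he

/-- The number of edges of a forest is the number of vertices minus the number of components. -/
theorem IsAcyclic.ncard_edgeSet_add_card_connectedComponent [Finite V] {F : SimpleGraph V}
    (hF : F.IsAcyclic) : F.edgeSet.ncard + Nat.card F.ConnectedComponent = Nat.card V := by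
  classical
  have := Fintype.ofFinite V
  have := Fintype.ofFinite F.ConnectedComponent
  have hdeg : ∀ (c : F.ConnectedComponent) (v : c), c.toSimpleGraph.degree v = F.degree v := by
    intro c v
    rw [← card_neighborFinset_eq_degree, ← card_neighborFinset_eq_degree]
    refine Finset.card_bij (fun w _ => w.1) ?_ ?_ ?_
    · intro w hw
      rw [mem_neighborFinset] at hw ⊢
      exact hw
    · intro _ _ _ _ h
      exact Subtype.ext h
    · intro w hw
      rw [mem_neighborFinset] at hw
      refine ⟨⟨w, ?_⟩, by rw [mem_neighborFinset]; exact hw, rfl⟩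
      exact (ConnectedComponent.mem_supp_congr_adj c hw).mp v.2
  have hsum : ∑ c : F.ConnectedComponent, ∑ v : c, F.degree v = 2 * F.edgeFinset.card := by
    rw [← F.sum_degrees_eq_twice_card_edges,
      ← Finset.sum_fiberwise Finset.univ F.connectedComponentMk]
    refine Finset.sum_congr rfl fun c _ => ?_
    rw [Finset.sum_subtype (p := fun v => v ∈ c)]
    intro v
    simp
    rfl
  have hcard : ∑ c : F.ConnectedComponent, Fintype.card c = Fintype.card V := by
    rw [← Fintype.card_sigma]
    refine Fintype.card_congr (Equiv.sigmaFiberEquiv F.connectedComponentMk)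
  -- A tree on `n` vertices has degree sum `2 (n - 1)`; the additive form avoids truncated
  -- subtraction.
  have hc : ∀ c : F.ConnectedComponent, ∑ v : c, F.degree v + 2 = 2 * Fintype.card c := by
    intro c
    have h1 := (hF.isTree_connectedComponent c).card_edgeFinset
    have h2 := c.toSimpleGraph.sum_degrees_eq_twice_card_edges
    rw [Finset.sum_congr rfl fun v _ => hdeg c v] at h2
    omega
  have h3 := Finset.sum_congr rfl fun c (_ : c ∈ Finset.univ) => hc c
  rw [Finset.sum_add_distrib, hsum, ← Finset.mul_sum, hcard, Finset.sum_const, smul_eq_mul,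
    Finset.card_univ] at h3
  rw [Nat.card_eq_fintype_card, Nat.card_eq_fintype_card, Set.ncard_eq_toFinset_card']
  change F.edgeFinset.card + _ = _
  omega

/-! ### Forest packings and edge exchanges -/

/-- A family of pairwise edge-disjoint forests in `G`. -/
structure IsForestPacking {ι : Type*} (G : SimpleGraph V) (T : ι → SimpleGraph V) : Prop where
  le : ∀ i, T i ≤ G
  isAcyclic : ∀ i, (T i).IsAcyclic
  disjoint : ∀ i j, i ≠ j → Disjoint (T i) (T j)

/-- The edges of `G` which no member of the family `T` uses. -/
def uncovered {ι : Type*} (G : SimpleGraph V) (T : ι → SimpleGraph V) : SimpleGraph V :=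
  G \ ⨆ i, T i

theorem uncovered_adj {ι : Type*} {G : SimpleGraph V} {T : ι → SimpleGraph V} {x y : V} :
    (G.uncovered T).Adj x y ↔ G.Adj x y ∧ ∀ i, ¬ (T i).Adj x y := by
  simp [uncovered]

/-- `T'` arises from `T` by replacing an edge of some `T i` by an edge `xy` not used by `T`, such
that the removed edge separates `x` from `y` in `T i`. -/
def EdgeExchange {ι : Type*} (G : SimpleGraph V) (T T' : ι → SimpleGraph V) : Prop :=
  ∃ (i : ι) (x y : V) (e : Sym2 V), (G.uncovered T).Adj x y ∧ e ∈ (T i).edgeSet ∧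
    ¬ ((T i).deleteEdges {e}).Reachable x y ∧
    T' i = (T i).deleteEdges {e} ⊔ edge x y ∧ ∀ j, j ≠ i → T' j = T j

theorem disjoint_edge_of_not_adj {K : SimpleGraph V} {x y : V} (h : ¬ K.Adj x y) :
    Disjoint K (edge x y) := by
  rw [edge, disjoint_fromEdgeSet, Set.disjoint_singleton_right]
  exact h

theorem ncard_edgeSet_sup_edge [Finite V] {K : SimpleGraph V} {x y : V} (hne : x ≠ y)
    (h : ¬ K.Adj x y) : (K ⊔ edge x y).edgeSet.ncard = K.edgeSet.ncard + 1 := by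
  rw [edgeSet_sup, edgeSet_edge_of_ne hne, Set.union_singleton,
    Set.ncard_insert_of_notMem (by rwa [mem_edgeSet])]

/-- Serves both moves: `K = T i` enlarges the packing, and `K = T i` minus an edge is an exchange.
-/
theorem IsForestPacking.replace {ι : Type*} {G : SimpleGraph V}
    {T T' : ι → SimpleGraph V} (hT : G.IsForestPacking T) {i : ι} {x y : V} {K : SimpleGraph V}
    (hxy : (G.uncovered T).Adj x y) (hK : K ≤ T i) (hr : ¬ K.Reachable x y)
    (hi : T' i = K ⊔ edge x y) (hj : ∀ j, j ≠ i → T' j = T j) : G.IsForestPacking T' := by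
  rw [uncovered_adj] at hxy
  have hdisj : ∀ j, j ≠ i → Disjoint (T' i) (T' j) := by
    intro j hji
    rw [hi, hj j hji]
    exact Disjoint.sup_left ((hT.disjoint i j hji.symm).mono_left hK)
      (disjoint_edge_of_not_adj (hxy.2 j)).symm
  constructor
  · intro j
    by_cases h : j = i
    · subst h
      rw [hi]
      refine sup_le (hK.trans (hT.le j)) ?_
      rw [edge, fromEdgeSet_le]
      rintro _ ⟨rfl, -⟩
      exact hxy.1
    · rw [hj j h]
      exact hT.le j
  · intro j
    by_cases h : j = i
    · subst h
      rw [hi]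
      exact ((hT.isAcyclic j).anti hK).sup_edge_of_not_reachable hr
    · rw [hj j h]
      exact hT.isAcyclic j
  · intro j l hjl
    by_cases h : j = i
    · subst h
      exact hdisj l hjl.symm
    · by_cases h' : l = i
      · subst h'
        exact (hdisj j h).symm
      · rw [hj j h, hj l h']
        exact hT.disjoint j l hjl

/-- The total number of edges of a family of graphs. -/
noncomputable def packingSize {ι : Type*} [Fintype ι] (T : ι → SimpleGraph V) : ℕ :=
  ∑ i, (T i).edgeSet.ncard

theorem EdgeExchange.isForestPacking {ι : Type*} {G : SimpleGraph V} {T T' : ι → SimpleGraph V}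
    (h : G.EdgeExchange T T') (hT : G.IsForestPacking T) : G.IsForestPacking T' := by
  obtain ⟨i, x, y, e, hxy, -, hr, hi, hj⟩ := h
  exact hT.replace hxy (deleteEdges_le _) hr hi hj

theorem EdgeExchange.packingSize_eq [Finite V] {ι : Type*} [Fintype ι] {G : SimpleGraph V}
    {T T' : ι → SimpleGraph V} (h : G.EdgeExchange T T') : packingSize T' = packingSize T := by
  obtain ⟨i, x, y, e, hxy, he, hr, hi, hj⟩ := h
  refine Finset.sum_congr rfl fun j _ => ?_
  by_cases h : j = i
  · subst h
    rw [hi, ncard_edgeSet_sup_edge hxy.ne (fun h => hr h.reachable), edgeSet_deleteEdges,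
      Set.ncard_sdiff_singleton_add_one he]
  · rw [hj j h]

/-- In a largest forest packing, the ends of an unused edge are connected in every member. -/
theorem IsForestPacking.reachable_of_uncovered [Finite V] {ι : Type*} [Fintype ι]
    {G : SimpleGraph V} {T : ι → SimpleGraph V} (hT : G.IsForestPacking T)
    (hmax : ∀ T' : ι → SimpleGraph V, G.IsForestPacking T' → packingSize T' ≤ packingSize T)
    {x y : V} (hxy : (G.uncovered T).Adj x y) (i : ι) : (T i).Reachable x y := by
  classical
  by_contra hr
  have hT' := hT.replace (T' := Function.update T i (T i ⊔ edge x y)) hxy le_rfl hr (by simp)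
    (fun j h => by simp [h])
  refine (hmax _ hT').not_gt (Finset.sum_lt_sum (fun j _ => ?_) ⟨i, Finset.mem_univ _, ?_⟩)
  · by_cases h : j = i
    · subst h
      rw [Function.update_self, ncard_edgeSet_sup_edge hxy.ne (fun h => hr h.reachable)]
      omega
    · rw [Function.update_of_ne h]
  · rw [Function.update_self, ncard_edgeSet_sup_edge hxy.ne (fun h => hr h.reachable)]
    omega

/-- The edges that can be made unused by a sequence of exchanges starting at `T`. -/
def exchangeClosure {ι : Type*} (G : SimpleGraph V) (T : ι → SimpleGraph V) : SimpleGraph V :=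
  ⨆ T' ∈ {T' | Relation.ReflTransGen G.EdgeExchange T T'}, G.uncovered T'

theorem uncovered_le_exchangeClosure {ι : Type*} {G : SimpleGraph V} {T T' : ι → SimpleGraph V}
    (h : Relation.ReflTransGen G.EdgeExchange T T') : G.uncovered T' ≤ G.exchangeClosure T :=
  le_iSup₂_of_le T' h le_rfl

theorem exchangeClosure_adj {ι : Type*} {G : SimpleGraph V} {T : ι → SimpleGraph V} {x y : V} :
    (G.exchangeClosure T).Adj x y ↔
      ∃ T', Relation.ReflTransGen G.EdgeExchange T T' ∧ (G.uncovered T').Adj x y := by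
  simp [exchangeClosure]

theorem IsForestPacking.of_reflTransGen [Finite V] {ι : Type*} [Fintype ι] {G : SimpleGraph V}
    {T₀ T : ι → SimpleGraph V} (hT₀ : G.IsForestPacking T₀)
    (h : Relation.ReflTransGen G.EdgeExchange T₀ T) :
    G.IsForestPacking T ∧ packingSize T = packingSize T₀ := by
  induction h with
  | refl => exact ⟨hT₀, rfl⟩
  | tail _ h ih => exact ⟨h.isForestPacking ih.1, h.packingSize_eq.trans ih.2⟩

/-- The ends of an edge unused by a largest packing `T` are joined in every member of `T` by a path
all of whose edges can be exchanged. -/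
theorem IsForestPacking.reachable_inf_exchangeClosure [Finite V] {ι : Type*} [Fintype ι]
    {G : SimpleGraph V} {T₀ T : ι → SimpleGraph V} (hT₀ : G.IsForestPacking T₀)
    (hmax : ∀ T' : ι → SimpleGraph V, G.IsForestPacking T' → packingSize T' ≤ packingSize T₀)
    (h : Relation.ReflTransGen G.EdgeExchange T₀ T) {x y : V} (hxy : (G.uncovered T).Adj x y)
    (i : ι) : (T i ⊓ G.exchangeClosure T₀).Reachable x y := by
  classical
  obtain ⟨hT, hsize⟩ := hT₀.of_reflTransGen h
  obtain ⟨p, hp⟩ :=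
    (hT.reachable_of_uncovered (fun T' h' => hsize ▸ hmax T' h') hxy i).exists_isPath
  refine ⟨p.transfer _ fun e he => ?_⟩
  have heT := p.edges_subset_edgeSet he
  rw [edgeSet_inf]
  refine ⟨heT, ?_⟩
  have hr := (hT.isAcyclic i).not_reachable_deleteEdges hp he
  let T' := Function.update T i ((T i).deleteEdges {e} ⊔ edge x y)
  have hex : G.EdgeExchange T T' :=
    ⟨i, x, y, e, hxy, heT, hr, by simp [T'], fun j h => by simp [T', h]⟩
  apply edgeSet_mono (uncovered_le_exchangeClosure (h.tail hex))
  induction e with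
  | _ u v =>
  rw [mem_edgeSet] at heT ⊢
  rw [uncovered_adj]
  refine ⟨hT.le i heT, fun j hj => ?_⟩
  -- The removed edge is now unused: the inserted `xy` was uncovered, hence differs from it, and the
  -- other forests are disjoint from `T i`.
  by_cases hji : j = i
  · subst hji
    simp only [T', Function.update_self, sup_adj, deleteEdges_adj, Set.mem_singleton_iff,
      not_true_eq_false, and_false, false_or] at hj
    have : s(u, v) = s(x, y) := by
      rw [edge, fromEdgeSet_adj] at hj
      exact hj.1
    rw [uncovered_adj] at hxy
    apply hxy.2 j
    rw [← mem_edgeSet, ← this]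
    exact heT
  · rw [show T' j = T j by simp [T', hji]] at hj
    have := hT.disjoint j i hji
    rw [← disjoint_edgeSet, Set.disjoint_left] at this
    exact this ((mem_edgeSet _).mpr hj) ((mem_edgeSet _).mpr heT)

/-- Exchanges do not change which vertices are connected by exchangeable edges of a member. -/
theorem IsForestPacking.reachable_inf_exchangeClosure_iff [Finite V] {ι : Type*} [Fintype ι]
    {G : SimpleGraph V} {T₀ T : ι → SimpleGraph V} (hT₀ : G.IsForestPacking T₀)
    (hmax : ∀ T' : ι → SimpleGraph V, G.IsForestPacking T' → packingSize T' ≤ packingSize T₀)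
    (h : Relation.ReflTransGen G.EdgeExchange T₀ T) (i : ι) (x y : V) :
    (T i ⊓ G.exchangeClosure T₀).Reachable x y ↔
      (T₀ i ⊓ G.exchangeClosure T₀).Reachable x y := by
  induction h generalizing x y with
  | refl => rfl
  | @tail T T' h hex ih =>
    rw [← ih]
    obtain ⟨j, a, b, e, hab, he, hr, hj, hne⟩ := hex
    by_cases hij : i = j
    swap
    · rw [hne i hij]
    subst hij
    set S := G.exchangeClosure T₀ with hS
    have hreach := hT₀.reachable_inf_exchangeClosure hmax h hab i
    rw [← hS] at hreach
    have habS : S.Adj a b := uncovered_le_exchangeClosure h hab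
    have hab' : (T' i ⊓ S).Reachable a b :=
      Adj.reachable ⟨by rw [hj]; simp [edge, fromEdgeSet_adj, hab.ne], habS⟩
    have hle : (T i ⊓ S).deleteEdges {e} ≤ T' i ⊓ S := by
      intro c d hcd
      rw [deleteEdges_adj] at hcd
      refine ⟨?_, hcd.1.2⟩
      rw [hj]
      exact Or.inl (deleteEdges_adj.mpr ⟨hcd.1.1, hcd.2⟩)
    have hnr : ¬ ((T i ⊓ S).deleteEdges {e}).Reachable a b := fun hh =>
      hr (hh.mono (deleteEdges_mono inf_le_left))
    constructor
    · refine Reachable.of_forall_adj fun c d hcd => ?_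
      rw [inf_adj, hj, sup_adj, deleteEdges_adj] at hcd
      rcases hcd with ⟨hcd | hcd, hcdS⟩
      · exact Adj.reachable ⟨hcd.1, hcdS⟩
      · rw [edge, fromEdgeSet_adj] at hcd
        rcases Sym2.eq_iff.mp hcd.1 with ⟨rfl, rfl⟩ | ⟨rfl, rfl⟩
        · exact hreach
        · exact hreach.symm
    · refine Reachable.of_forall_adj fun c d hcd => ?_
      by_cases hcde : s(c, d) = e
      · subst hcde
        -- The connection from `a` to `b` must use the removed edge `cd`; its two remaining pieces
        -- together with the new edge `ab` rejoin `c` and `d`.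
        rcases hreach.deleteEdges_cases (u := c) (v := d) with h | h | h
        · exact absurd h hnr
        · exact ((h.1.mono hle).symm.trans hab').trans (h.2.mono hle).symm
        · exact (((h.1.mono hle).symm.trans hab').trans (h.2.mono hle).symm).symm
      · exact (Adj.reachable (deleteEdges_adj.mpr ⟨hcd, hcde⟩)).mono hle

theorem exists_maximum_forestPacking [Finite V] {ι : Type*} [Fintype ι] (G : SimpleGraph V) :
    ∃ T : ι → SimpleGraph V, G.IsForestPacking T ∧
      ∀ T' : ι → SimpleGraph V, G.IsForestPacking T' → packingSize T' ≤ packingSize T := by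
  have hne : {T : ι → SimpleGraph V | G.IsForestPacking T}.Nonempty :=
    ⟨fun _ => ⊥, fun _ => bot_le, fun _ => isAcyclic_bot, fun _ _ _ => disjoint_bot_left⟩
  obtain ⟨T, hT, hmax⟩ := Set.exists_max_image _ packingSize (Set.toFinite _) hne
  exact ⟨T, hT, hmax⟩

/-! ### The tree packing theorem -/

/-- The Nash-Williams–Tutte tree packing theorem: if for every partition of the vertices into `t`
parts at least `k (t - 1)` edges join different parts, there are `k` edge-disjoint spanning
trees. -/
theorem hasEdgeDisjointSpanningTrees_of_partition {V : Type u} [Finite V] [Nonempty V]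
    (G : SimpleGraph V) (k : ℕ)
    (h : ∀ (P : Type u) (f : V → P), Function.Surjective f →
      k * Nat.card P ≤ (G ⊓ (⊤ : SimpleGraph P).comap f).edgeSet.ncard + k) :
    G.HasEdgeDisjointSpanningTrees k := by
  classical
  obtain ⟨T, hT, hmax⟩ := exists_maximum_forestPacking (ι := Fin k) G
  set S := G.exchangeClosure T with hS
  have hreach : ∀ i, (T i ⊓ S).Reachable = S.Reachable := by
    intro i
    ext x y
    refine ⟨fun h => h.mono inf_le_right, Reachable.of_forall_adj fun a b hab => ?_⟩
    obtain ⟨T', hT', hab'⟩ := exchangeClosure_adj.mp hab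
    exact (hT.reachable_inf_exchangeClosure_iff hmax hT' i a b).mp
      (hT.reachable_inf_exchangeClosure hmax hT' hab' i)
  have hin : ∀ i, (T i ⊓ S).edgeSet.ncard + Nat.card S.ConnectedComponent = Nat.card V := by
    intro i
    rw [← ((hT.isAcyclic i).anti inf_le_left).ncard_edgeSet_add_card_connectedComponent]
    -- Components are the quotient by reachability, so equal reachability relations give equal
    -- counts.
    unfold ConnectedComponent
    rw [hreach i]
  have htot := fun i => (hT.isAcyclic i).ncard_edgeSet_add_card_connectedComponent
  have hsplit : ∀ i, (T i).edgeSet.ncard = (T i ⊓ S).edgeSet.ncard + (T i \ S).edgeSet.ncard := by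
    intro i
    rw [edgeSet_inf, edgeSet_sdiff, Set.ncard_inter_add_ncard_sdiff_eq_ncard]
  have hcross := h S.ConnectedComponent S.connectedComponentMk Quot.mk_surjective
  have hsub : (G ⊓ (⊤ : SimpleGraph S.ConnectedComponent).comap
      S.connectedComponentMk).edgeSet ⊆ ⋃ i ∈ (Finset.univ : Finset (Fin k)),
        (T i \ S).edgeSet := by
    intro e
    induction e with
    | _ x y =>
    rw [mem_edgeSet, inf_adj, comap_adj, top_adj]
    rintro ⟨hxy, hne⟩
    have hS' : ¬ S.Adj x y := fun h => hne (ConnectedComponent.sound h.reachable)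
    have : ¬ (G.uncovered T).Adj x y := fun h =>
      hS' (uncovered_le_exchangeClosure Relation.ReflTransGen.refl h)
    rw [uncovered_adj] at this
    push Not at this
    obtain ⟨i, hi⟩ := this hxy
    simp only [Set.mem_iUnion, Finset.mem_univ, exists_prop, true_and]
    exact ⟨i, hi, hS'⟩
  have hle : (G ⊓ (⊤ : SimpleGraph S.ConnectedComponent).comap
      S.connectedComponentMk).edgeSet.ncard ≤ ∑ i, (T i \ S).edgeSet.ncard :=
    (Set.ncard_le_ncard hsub (Set.toFinite _)).trans (Finset.set_ncard_biUnion_le _ _)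
  have hpos : ∀ i, 1 ≤ Nat.card (T i).ConnectedComponent := fun i => Nat.card_pos
  have hdiff : ∀ i, (T i \ S).edgeSet.ncard + Nat.card (T i).ConnectedComponent =
      Nat.card S.ConnectedComponent := by
    intro i
    have := hin i
    have := htot i
    have := hsplit i
    omega
  have hsum : ∑ i, ((T i \ S).edgeSet.ncard + Nat.card (T i).ConnectedComponent) =
      k * Nat.card S.ConnectedComponent := by
    simp only [hdiff, Finset.sum_const, Finset.card_univ, Fintype.card_fin, smul_eq_mul]
  rw [Finset.sum_add_distrib] at hsum
  -- With `t` components of `S` and `c i` of `T i`, `k (t - 1) ≤ ∑ (t - c i)`, so the `c i` sum to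
  -- at most `k`.
  have hk : ∑ i : Fin k, Nat.card (T i).ConnectedComponent ≤ ∑ i : Fin k, 1 := by
    rw [Finset.sum_const, Finset.card_univ, Fintype.card_fin, smul_eq_mul]
    omega
  have hone : ∀ i, Nat.card (T i).ConnectedComponent = 1 := by
    intro i
    have := (Finset.sum_eq_sum_iff_of_le fun i _ => hpos i).mp
      (le_antisymm (Finset.sum_le_sum fun i _ => hpos i) hk) i (Finset.mem_univ i)
    exact this.symm
  refine ⟨T, fun i => ⟨hT.le i, ⟨?_, hT.isAcyclic i⟩⟩, fun i j hij =>
    disjoint_edgeSet.mpr (hT.disjoint i j hij)⟩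
  refine (connected_iff _).mpr ⟨fun x y => ?_, inferInstance⟩
  have : Subsingleton (T i).ConnectedComponent := (Nat.card_eq_one_iff_unique.mp (hone i)).1
  exact ConnectedComponent.exact (Subsingleton.elim _ _)

end SimpleGraph

/-! ### Rayleigh quotients and the second eigenvalue -/

open Finset Matrix

/-- Every two-dimensional space of vectors contains one whose Rayleigh quotient is at most the
second eigenvalue. -/
theorem LinearMap.IsSymmetric.exists_inner_le_second_eigenvalue {E : Type*}
    [NormedAddCommGroup E] [InnerProductSpace ℝ E] [FiniteDimensional ℝ E] {T : E →ₗ[ℝ] E}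
    (hT : T.IsSymmetric) {n : ℕ} (hn : Module.finrank ℝ E = n) (h1 : 1 < n) (u v : E) :
    ∃ c d : ℝ, (c ≠ 0 ∨ d ≠ 0) ∧
      inner ℝ (c • u + d • v) (T (c • u + d • v)) ≤
        hT.eigenvalues hn ⟨1, h1⟩ * inner ℝ (c • u + d • v) (c • u + d • v) := by
  let b := hT.eigenvectorBasis hn
  let i₀ : Fin n := ⟨0, by omega⟩
  -- Orthogonality to the top eigenvector is one linear condition on two coefficients. Independence
  -- of `u` and `v` is not needed.
  obtain ⟨c, d, hcd, horth⟩ : ∃ c d : ℝ, (c ≠ 0 ∨ d ≠ 0) ∧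
      inner ℝ (b i₀) (c • u + d • v) = 0 := by
    by_cases hu : inner ℝ (b i₀) u = 0
    · exact ⟨1, 0, Or.inl one_ne_zero, by simp [hu]⟩
    · refine ⟨inner ℝ (b i₀) v, -inner ℝ (b i₀) u, Or.inr (neg_ne_zero.mpr hu), ?_⟩
      simp only [inner_add_right, inner_smul_right]
      ring
  refine ⟨c, d, hcd, ?_⟩
  generalize c • u + d • v = w at horth
  rw [← b.sum_inner_mul_inner w (T w), ← b.sum_inner_mul_inner w w, mul_sum]
  refine sum_le_sum fun i _ => ?_
  have hTb : inner ℝ (b i) (T w) = hT.eigenvalues hn i * inner ℝ (b i) w := by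
    rw [← hT, hT.apply_eigenvectorBasis]
    simp [inner_smul_left, b]
  rw [hTb, real_inner_comm (b i) w]
  by_cases hi : i = i₀
  · subst hi
    simp [horth]
  · have hle : hT.eigenvalues hn i ≤ hT.eigenvalues hn ⟨1, h1⟩ := by
      apply hT.eigenvalues_antitone hn
      rw [Fin.le_def]
      have : i.val ≠ 0 := fun h => hi (Fin.ext h)
      change 1 ≤ i.val
      omega
    nlinarith [mul_le_mul_of_nonneg_right hle (mul_self_nonneg (inner ℝ (b i) w))]

namespace SimpleGraph

variable {V : Type*} [Fintype V] [DecidableEq V]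

theorem exists_quadraticForm_le_secondEigenvalue (G : SimpleGraph V) [DecidableRel G.Adj]
    (h : 1 < Fintype.card V) (u v : V → ℝ) :
    ∃ c d : ℝ, (c ≠ 0 ∨ d ≠ 0) ∧
      (c • u + d • v) ⬝ᵥ G.adjMatrix ℝ *ᵥ (c • u + d • v) ≤
        G.secondEigenvalue * ((c • u + d • v) ⬝ᵥ (c • u + d • v)) := by
  obtain ⟨c, d, hcd, hle⟩ := (Matrix.isSymmetric_toEuclideanLin_iff.mpr
    G.adjMatrix_real_isHermitian).exists_inner_le_second_eigenvalue finrank_euclideanSpace h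
      (WithLp.toLp 2 u) (WithLp.toLp 2 v)
  refine ⟨c, d, hcd, ?_⟩
  have hl : G.secondEigenvalue = (Matrix.isSymmetric_toEuclideanLin_iff.mpr
    G.adjMatrix_real_isHermitian).eigenvalues finrank_euclideanSpace ⟨1, h⟩ := by
    rw [secondEigenvalue, dif_pos h]
    rfl
  rw [← hl, EuclideanSpace.inner_eq_star_dotProduct, EuclideanSpace.inner_eq_star_dotProduct,
    star_trivial, dotProduct_comm] at hle
  exact hle

/-- If a binary quadratic form with positive diagonal is not positive definite, its off-diagonal
entry dominates. -/
theorem _root_.mul_le_sq_of_quadraticForm_nonpos {p q r p' q' c d : ℝ} (hcd : c ≠ 0 ∨ d ≠ 0)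
    (hp : 0 < p') (hq : 0 < q') (hpp : p' ≤ p) (hqq : q' ≤ q)
    (h : c ^ 2 * p + 2 * (c * d) * r + d ^ 2 * q ≤ 0) : p' * q' ≤ r ^ 2 := by
  have h' : c ^ 2 * p' + 2 * (c * d) * r + d ^ 2 * q' ≤ 0 := by
    nlinarith [mul_le_mul_of_nonneg_left hpp (sq_nonneg c),
      mul_le_mul_of_nonneg_left hqq (sq_nonneg d)]
  by_contra hlt
  push Not at hlt
  -- `q'` times the form is `(d q' + c r)² + c² (p' q' - r²)`, positive if `c ≠ 0`; the other case
  -- is symmetric.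
  rcases hcd with hc | hd
  · nlinarith [sq_nonneg (d * q' + c * r), mul_pos (pow_pos (abs_pos.mpr hc) 2) (sub_pos.mpr hlt),
      sq_abs c, mul_le_mul_of_nonneg_right h' hq.le]
  · nlinarith [sq_nonneg (c * p' + d * r), mul_pos (pow_pos (abs_pos.mpr hd) 2) (sub_pos.mpr hlt),
      sq_abs d, mul_le_mul_of_nonneg_right h' hp.le]

end SimpleGraph

/-! ### Edge counts, volumes and boundaries of parts -/

namespace SimpleGraph

variable {V : Type*} [Fintype V] [DecidableEq V]

/-- The number of ordered pairs of adjacent vertices in `S × T`, as a real number. -/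
noncomputable def edgeWeight (G : SimpleGraph V) [DecidableRel G.Adj] (S T : Finset V) : ℝ :=
  (fun v => if v ∈ S then 1 else 0) ⬝ᵥ G.adjMatrix ℝ *ᵥ (fun v => if v ∈ T then 1 else 0)

/-- The sum of the degrees of the vertices in `S`, as a real number. -/
noncomputable def volume (G : SimpleGraph V) [DecidableRel G.Adj] (S : Finset V) : ℝ :=
  ∑ v ∈ S, (G.degree v : ℝ)

/-- The number of edges leaving `S`, as a real number. -/
noncomputable def boundary (G : SimpleGraph V) [DecidableRel G.Adj] (S : Finset V) : ℝ :=
  G.volume S - G.edgeWeight S S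

theorem edgeWeight_eq_sum (G : SimpleGraph V) [DecidableRel G.Adj] (S T : Finset V) :
    G.edgeWeight S T = ∑ v ∈ S, ∑ w ∈ T, G.adjMatrix ℝ v w := by
  simp [edgeWeight, dotProduct, mulVec]

theorem edgeWeight_nonneg (G : SimpleGraph V) [DecidableRel G.Adj] (S T : Finset V) :
    0 ≤ G.edgeWeight S T := by
  rw [edgeWeight_eq_sum]
  refine sum_nonneg fun v _ => sum_nonneg fun w _ => ?_
  rw [adjMatrix_apply]
  split_ifs <;> norm_num

theorem edgeWeight_comm (G : SimpleGraph V) [DecidableRel G.Adj] (S T : Finset V) :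
    G.edgeWeight S T = G.edgeWeight T S := by
  simp only [edgeWeight_eq_sum, adjMatrix_apply]
  rw [sum_comm]
  simp only [G.adj_comm]

variable {P : Type*} [Fintype P] [DecidableEq P]

theorem sum_edgeWeight_fiber (G : SimpleGraph V) [DecidableRel G.Adj] (f : V → P) (S : Finset V) :
    ∑ q, G.edgeWeight S {v | f v = q} = G.volume S := by
  simp only [edgeWeight_eq_sum]
  rw [sum_comm, volume]
  refine sum_congr rfl fun v _ => ?_
  rw [sum_fiberwise, ← card_neighborFinset_eq_degree, neighborFinset_eq_filter]
  simp [adjMatrix_apply]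

theorem boundary_fiber (G : SimpleGraph V) [DecidableRel G.Adj] (f : V → P) (p : P) :
    G.boundary {v | f v = p} =
      ∑ q ∈ univ.erase p, G.edgeWeight {v | f v = p} {v | f v = q} := by
  rw [boundary, ← G.sum_edgeWeight_fiber f, ← add_sum_erase _ _ (mem_univ p), add_sub_cancel_left]

/-- Each crossing edge leaves the parts of both its ends, hence the factor 2. -/
theorem sum_boundary_fiber (G : SimpleGraph V) [DecidableRel G.Adj] (f : V → P) :
    ∑ p, G.boundary {v | f v = p} =
      2 * ((G ⊓ (⊤ : SimpleGraph P).comap f).edgeSet.ncard : ℝ) := by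
  classical
  have h := (G ⊓ (⊤ : SimpleGraph P).comap f).sum_degrees_eq_twice_card_edges
  rw [edgeFinset, ← Set.ncard_eq_toFinset_card'] at h
  have h' : (∑ v, ((G ⊓ (⊤ : SimpleGraph P).comap f).degree v : ℝ)) =
      2 * ((G ⊓ (⊤ : SimpleGraph P).comap f).edgeSet.ncard : ℝ) := by
    exact_mod_cast h
  rw [← h', ← sum_fiberwise univ f]
  refine sum_congr rfl fun p _ => ?_
  rw [boundary, volume, edgeWeight_eq_sum, ← sum_sub_distrib]
  refine sum_congr rfl fun v hv => ?_
  rw [mem_filter_univ] at hv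
  subst hv
  rw [← card_neighborFinset_eq_degree, ← card_neighborFinset_eq_degree,
    neighborFinset_eq_filter, neighborFinset_eq_filter, card_filter, card_filter, sum_filter]
  push_cast
  rw [← sum_sub_distrib]
  refine sum_congr rfl fun w _ => ?_
  by_cases h1 : G.Adj v w <;> by_cases h2 : f w = f v <;> simp [h1, h2, adjMatrix_apply, Ne.symm]

/-- If the parts of a partition of `V` satisfy pairwise `e(S, T)² ≥ (m - ∂S)(m - ∂T)` whenever
both factors are positive, then the deficiencies `m - ∂S` add up to at most `m`. -/
theorem sum_sub_boundary_le (G : SimpleGraph V) [DecidableRel G.Adj] (f : V → P) {m : ℝ}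
    (hm : 0 ≤ m)
    (h : ∀ p q, p ≠ q → G.boundary {v | f v = p} < m → G.boundary {v | f v = q} < m →
      (m - G.boundary {v | f v = p}) * (m - G.boundary {v | f v = q}) ≤
        G.edgeWeight {v | f v = p} {v | f v = q} ^ 2) :
    ∑ p, (m - G.boundary {v | f v = p}) ≤ m := by
  rcases isEmpty_or_nonempty P with hP | hP
  · simpa using hm
  obtain ⟨p, -, hp⟩ := exists_min_image univ (fun p => G.boundary {v | f v = p}) univ_nonempty
  have key : ∀ q ∈ univ.erase p,
      m - G.boundary {v | f v = q} ≤ G.edgeWeight {v | f v = p} {v | f v = q} := by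
    intro q hq
    rcases le_or_gt m (G.boundary {v | f v = q}) with hmq | hmq
    · exact (sub_nonpos.mpr hmq).trans (G.edgeWeight_nonneg _ _)
    · have hle := hp q (mem_univ q)
      have h2 := h p q (ne_of_mem_erase hq).symm (hle.trans_lt hmq) hmq
      refine (sq_le_sq₀ (sub_nonneg.mpr hmq.le) (G.edgeWeight_nonneg _ _)).mp ?_
      nlinarith
  have := sum_le_sum key
  rw [← boundary_fiber] at this
  rw [← add_sum_erase _ _ (mem_univ p)]
  linarith

end SimpleGraph

/-! ### Sets of small boundary in biregular graphs -/

namespace SimpleGraph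

variable {V : Type*} [Fintype V] {G : SimpleGraph V} [DecidableRel G.Adj]
  {X Y : Set V} {a b : ℕ}

namespace IsBiregularBipartite

theorem mem_right_iff (hG : G.IsBiregularBipartite X Y a b) {v : V} : v ∈ Y ↔ v ∉ X := by
  have h : v ∈ X ∪ Y := hG.union_eq_univ ▸ Set.mem_univ v
  exact ⟨fun hY hX => Set.disjoint_left.mp hG.isBipartiteWith.disjoint hX hY,
    fun hX => h.resolve_left hX⟩

theorem mem_left_iff_of_adj (hG : G.IsBiregularBipartite X Y a b) {v w : V} (h : G.Adj v w) :
    v ∈ X ↔ w ∉ X := by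
  rcases hG.isBipartiteWith.mem_of_adj h with h | h
  · exact iff_of_true h.1 (hG.mem_right_iff.mp h.2)
  · exact iff_of_false (hG.mem_right_iff.mp h.1) (not_not.mpr h.2)

theorem degree_of_notMem (hG : G.IsBiregularBipartite X Y a b) {v : V} (h : v ∉ X) :
    G.degree v = b :=
  hG.degree_right v (hG.mem_right_iff.mpr h)

variable [DecidablePred (· ∈ X)]

theorem volume_eq (hG : G.IsBiregularBipartite X Y a b) (S : Finset V) :
    G.volume S = a * #{v ∈ S | v ∈ X} + b * #{v ∈ S | v ∉ X} := by
  rw [volume, ← sum_filter_add_sum_filter_not S (· ∈ X)]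
  congr 1
  · rw [sum_congr rfl fun v hv => by rw [hG.degree_left v (mem_filter.mp hv).2], sum_const,
      nsmul_eq_mul, mul_comm]
  · rw [sum_congr rfl fun v hv => by rw [hG.degree_of_notMem (mem_filter.mp hv).2], sum_const,
      nsmul_eq_mul, mul_comm]

variable [DecidableEq V]

theorem edgeWeight_self_le (hG : G.IsBiregularBipartite X Y a b) (S : Finset V) :
    G.edgeWeight S S ≤ 2 * (#{v ∈ S | v ∈ X} * #{v ∈ S | v ∉ X}) := by
  have h : ∀ v w, G.adjMatrix ℝ v w ≤
      (if v ∈ X then 1 else 0) * (if w ∉ X then 1 else 0) +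
        (if v ∉ X then 1 else 0) * (if w ∈ X then 1 else 0) := by
    intro v w
    rw [adjMatrix_apply]
    split_ifs with h1 h2 h3 h4 <;> norm_num
    all_goals have := hG.mem_left_iff_of_adj h1
    all_goals tauto
  rw [edgeWeight_eq_sum]
  refine (sum_le_sum fun v _ => sum_le_sum fun w _ => h v w).trans (le_of_eq ?_)
  simp only [sum_add_distrib, ← mul_sum, ← sum_mul, sum_boole]
  ring

/-- A nonempty set with small boundary has more than `b / 2` vertices on the left. -/
theorem lt_two_mul_card_left (hG : G.IsBiregularBipartite X Y a b) {S : Finset V}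
    (hS : S.Nonempty) {m : ℝ} (ha : m ≤ a) (hb : m ≤ b) (h : G.boundary S < m) :
    b < 2 * #{v ∈ S | v ∈ X} := by
  by_contra! hle
  have h1 := hG.edgeWeight_self_le S
  rw [boundary, hG.volume_eq] at h
  have hle' : (2 : ℝ) * #{v ∈ S | v ∈ X} ≤ b := by exact_mod_cast hle
  have hy : (0 : ℝ) ≤ #{v ∈ S | v ∉ X} := Nat.cast_nonneg _
  -- With `x` left and `y` right vertices, the boundary is at least `a x + y (b - 2 x)`: at least
  -- `a` if `x ≥ 1`, and at least `b` if `x = 0`, as then `y ≥ 1`.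
  rcases Nat.eq_zero_or_pos #{v ∈ S | v ∈ X} with hx | hx
  · have hc := card_filter_add_card_filter_not (s := S) (· ∈ X)
    have hpos : 1 ≤ #{v ∈ S | v ∉ X} := by
      have := hS.card_pos
      omega
    have hpos' : (1 : ℝ) ≤ #{v ∈ S | v ∉ X} := by exact_mod_cast hpos
    rw [hx] at h1 h
    push_cast at h1 h
    nlinarith [(Nat.cast_nonneg b : (0 : ℝ) ≤ b)]
  · have hx' : (1 : ℝ) ≤ #{v ∈ S | v ∈ X} := by exact_mod_cast hx
    nlinarith [mul_le_mul_of_nonneg_left hle' hy, (Nat.cast_nonneg a : (0 : ℝ) ≤ a)]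

/-- A nonempty set with small boundary has more than `a / 2` vertices on the right. -/
theorem lt_two_mul_card_right (hG : G.IsBiregularBipartite X Y a b) {S : Finset V}
    (hS : S.Nonempty) {m : ℝ} (ha : m ≤ a) (hb : m ≤ b) (h : G.boundary S < m) :
    a < 2 * #{v ∈ S | v ∉ X} := by
  classical
  have hG' : G.IsBiregularBipartite Y X b a :=
    ⟨hG.isBipartiteWith.symm, by rw [Set.union_comm, hG.union_eq_univ], hG.degree_right,
      hG.degree_left⟩
  have := hG'.lt_two_mul_card_left hS hb ha h
  simpa only [hG.mem_right_iff] using this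

/-- AM-GM applied to `a x + b y`, after rounding the bounds on `x` and `y` up to integers; this is
the source of the ceilings in the main theorem. -/
theorem le_volume (hG : G.IsBiregularBipartite X Y a b) {S : Finset V}
    (hS : S.Nonempty) {m : ℝ} (ha : m ≤ a) (hb : m ≤ b) (h : G.boundary S < m) :
    2 * (√((a : ℝ) * b) * √((⌈((a : ℝ) + 1) / 2⌉ : ℝ) * (⌈((b : ℝ) + 1) / 2⌉ : ℝ))) ≤
      G.volume S := by
  have hx := hG.lt_two_mul_card_left hS ha hb h
  have hy := hG.lt_two_mul_card_right hS ha hb h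
  have hceil : ∀ n t : ℕ, n < 2 * t → (⌈((n : ℝ) + 1) / 2⌉ : ℝ) ≤ t := by
    intro n t hnt
    have h1 : ⌈((n : ℝ) + 1) / 2⌉ ≤ (t : ℤ) := by
      rw [Int.ceil_le]
      have : ((n : ℝ) + 1) ≤ 2 * t := by exact_mod_cast hnt
      push_cast
      linarith
    exact_mod_cast h1
  have hceil0 : ∀ n : ℕ, (0 : ℝ) ≤ (⌈((n : ℝ) + 1) / 2⌉ : ℝ) := by
    intro n
    exact_mod_cast Int.ceil_nonneg (by positivity : (0 : ℝ) ≤ ((n : ℝ) + 1) / 2)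
  rw [hG.volume_eq]
  set x := ((#{v ∈ S | v ∈ X} : ℕ) : ℝ)
  set y := ((#{v ∈ S | v ∉ X} : ℕ) : ℝ)
  have hx0 : 0 ≤ x := Nat.cast_nonneg _
  have hy0 : 0 ≤ y := Nat.cast_nonneg _
  have ha0 : (0 : ℝ) ≤ a := Nat.cast_nonneg _
  have hb0 : (0 : ℝ) ≤ b := Nat.cast_nonneg _
  have hprod : (⌈((a : ℝ) + 1) / 2⌉ : ℝ) * (⌈((b : ℝ) + 1) / 2⌉ : ℝ) ≤ y * x :=
    mul_le_mul (hceil _ _ hy) (hceil _ _ hx) (hceil0 b) hy0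
  calc 2 * (√((a : ℝ) * b) * √((⌈((a : ℝ) + 1) / 2⌉ : ℝ) * (⌈((b : ℝ) + 1) / 2⌉ : ℝ)))
      ≤ 2 * (√((a : ℝ) * b) * √(y * x)) := by gcongr
    _ = 2 * (√(a * x) * √(b * y)) := by
        rw [← Real.sqrt_mul (by positivity), ← Real.sqrt_mul (by positivity)]
        congr 2
        ring
    _ ≤ a * x + b * y := by
        have h1 := Real.sq_sqrt (mul_nonneg ha0 hx0)
        have h2 := Real.sq_sqrt (mul_nonneg hb0 hy0)
        nlinarith [sq_nonneg (√(a * x) - √(b * y))]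

end IsBiregularBipartite

/-- The vector of square roots of the degrees, restricted to `S`. -/
noncomputable def sqrtDegreeOn {V : Type*} [Fintype V] [DecidableEq V] (G : SimpleGraph V)
    [DecidableRel G.Adj] (S : Finset V) (v : V) : ℝ :=
  √(G.degree v) * if v ∈ S then 1 else 0

variable [DecidableEq V]

theorem sqrtDegreeOn_dotProduct_self (S : Finset V) :
    G.sqrtDegreeOn S ⬝ᵥ G.sqrtDegreeOn S = G.volume S := by
  have h : ∀ v, G.sqrtDegreeOn S v * G.sqrtDegreeOn S v = if v ∈ S then (G.degree v : ℝ) else 0 := by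
    intro v
    rw [sqrtDegreeOn]
    split_ifs
    · simp
    · simp
  simp only [dotProduct, h, volume, sum_ite_mem, univ_inter]

theorem sqrtDegreeOn_dotProduct_of_disjoint {S T : Finset V} (h : Disjoint S T) :
    G.sqrtDegreeOn S ⬝ᵥ G.sqrtDegreeOn T = 0 := by
  refine sum_eq_zero fun v _ => ?_
  by_cases hS : v ∈ S
  · simp [sqrtDegreeOn, Finset.disjoint_left.mp h hS]
  · simp [sqrtDegreeOn, hS]

namespace IsBiregularBipartite

/-- Every edge joins degree `a` to degree `b`, so each adjacent pair contributes the same weight `√a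
√b`. -/
theorem sqrtDegreeOn_mulVec (hG : G.IsBiregularBipartite X Y a b) (S T : Finset V) :
    G.sqrtDegreeOn S ⬝ᵥ G.adjMatrix ℝ *ᵥ G.sqrtDegreeOn T = √((a : ℝ) * b) * G.edgeWeight S T := by
  simp only [edgeWeight, dotProduct, mulVec, mul_sum]
  refine sum_congr rfl fun v _ => sum_congr rfl fun w _ => ?_
  rw [adjMatrix_apply, sqrtDegreeOn, sqrtDegreeOn]
  by_cases h : G.Adj v w
  · have : √(G.degree v : ℝ) * √(G.degree w : ℝ) = √((a : ℝ) * b) := by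
      rw [← Real.sqrt_mul (Nat.cast_nonneg _)]
      have hiff := hG.mem_left_iff_of_adj h
      by_cases hv : v ∈ X
      · rw [hG.degree_left v hv, hG.degree_of_notMem (hiff.mp hv)]
      · rw [hG.degree_of_notMem hv, hG.degree_left w (by tauto), mul_comm]
    rw [← this, if_pos h]
    ring
  · simp [h]


/-- If the second eigenvalue is at most `√(ab) - μ`, any two disjoint sets `S` and `T` of
volume at least `√(ab) m / μ` and boundary less than `m` are joined by many edges. -/
theorem mul_le_edgeWeight_sq (hG : G.IsBiregularBipartite X Y a b) (hab : 0 < √((a : ℝ) * b))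
    (hV : 1 < Fintype.card V) {μ m : ℝ} (hμ : G.secondEigenvalue ≤ √((a : ℝ) * b) - μ)
    {S T : Finset V} (hST : Disjoint S T) (hS : √((a : ℝ) * b) * m ≤ μ * G.volume S)
    (hT : √((a : ℝ) * b) * m ≤ μ * G.volume T) (hSm : G.boundary S < m) (hTm : G.boundary T < m) :
    (m - G.boundary S) * (m - G.boundary T) ≤ G.edgeWeight S T ^ 2 := by
  obtain ⟨c, d, hcd, hle⟩ := G.exists_quadraticForm_le_secondEigenvalue hV
    (G.sqrtDegreeOn S) (G.sqrtDegreeOn T)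
  simp only [mulVec_add, mulVec_smul, add_dotProduct, dotProduct_add, smul_dotProduct,
    dotProduct_smul, smul_eq_mul, hG.sqrtDegreeOn_mulVec, sqrtDegreeOn_dotProduct_self,
    sqrtDegreeOn_dotProduct_of_disjoint hST, sqrtDegreeOn_dotProduct_of_disjoint hST.symm,
    G.edgeWeight_comm T S] at hle
  have hvol : ∀ U, 0 ≤ G.volume U := fun U => sum_nonneg fun v _ => Nat.cast_nonneg _
  -- Substituting `e(U, U) = vol U - ∂U`, the right side is at least `μ vol U - √(ab) ∂U`.
  have hdiag : ∀ U, √((a : ℝ) * b) * m ≤ μ * G.volume U → √((a : ℝ) * b) * (m - G.boundary U) ≤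
      √((a : ℝ) * b) * G.edgeWeight U U - G.secondEigenvalue * G.volume U := by
    intro U hU
    have := mul_le_mul_of_nonneg_right hμ (hvol U)
    rw [boundary]
    linarith
  have key := mul_le_sq_of_quadraticForm_nonpos hcd (mul_pos hab (sub_pos.mpr hSm))
    (mul_pos hab (sub_pos.mpr hTm)) (hdiag S hS) (hdiag T hT)
    (r := √((a : ℝ) * b) * G.edgeWeight S T) (by linarith)
  have hpos := mul_pos hab hab
  refine le_of_mul_le_mul_left ?_ hpos
  linarith

end IsBiregularBipartite

end SimpleGraph

theorem mainTheorem3 {V : Type*} [Fintype V] [DecidableEq V] [Nonempty V]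
    (G : SimpleGraph V) [DecidableRel G.Adj] (X Y : Set V) (a b k : ℕ)
    (hG : G.IsBiregularBipartite X Y a b)
    (ha : 2 * k ≤ a) (hb : 2 * k ≤ b)
    (hlam : G.secondEigenvalue ≤ Real.sqrt ((a : ℝ) * (b : ℝ)) -
      (k : ℝ) / Real.sqrt ((⌈((a : ℝ) + 1) / 2⌉ : ℝ) * (⌈((b : ℝ) + 1) / 2⌉ : ℝ))) :
    G.HasEdgeDisjointSpanningTrees k := by
  classical
  rcases Nat.eq_zero_or_pos k with rfl | hk
  · exact ⟨fun i => i.elim0, fun i => i.elim0, fun i => i.elim0⟩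
  have ha0 : (0 : ℝ) < a := by exact_mod_cast (by omega : 0 < a)
  have hb0 : (0 : ℝ) < b := by exact_mod_cast (by omega : 0 < b)
  have ha' : 2 * (k : ℝ) ≤ a := by exact_mod_cast ha
  have hb' : 2 * (k : ℝ) ≤ b := by exact_mod_cast hb
  have hab : 0 < √((a : ℝ) * b) := Real.sqrt_pos.mpr (mul_pos ha0 hb0)
  refine G.hasEdgeDisjointSpanningTrees_of_partition k fun P f hf => ?_
  have := Finite.of_surjective f hf
  have := Fintype.ofFinite P
  set r := √((⌈((a : ℝ) + 1) / 2⌉ : ℝ) * (⌈((b : ℝ) + 1) / 2⌉ : ℝ)) with hr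
  have hr0 : 0 < r := by
    have h : ∀ n : ℕ, (0 : ℝ) < (⌈((n : ℝ) + 1) / 2⌉ : ℝ) := fun n => by
      exact_mod_cast Int.ceil_pos.mpr (by positivity : (0 : ℝ) < ((n : ℝ) + 1) / 2)
    exact Real.sqrt_pos.mpr (mul_pos (h a) (h b))
  have hvol : ∀ p, G.boundary {v | f v = p} < 2 * (k : ℝ) →
      √((a : ℝ) * b) * (2 * k) ≤ k / r * G.volume {v | f v = p} := by
    intro p hp
    obtain ⟨v, hv⟩ := hf p
    have := hG.le_volume ⟨v, by simpa using hv⟩ ha' hb' hp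
    rw [div_mul_eq_mul_div, le_div_iff₀ hr0]
    linarith [mul_le_mul_of_nonneg_left this (Nat.cast_nonneg k : (0 : ℝ) ≤ k)]
  -- The threshold is `2k` because boundaries count crossing edges twice.
  have hsum := G.sum_sub_boundary_le f (m := 2 * k) (by positivity) fun p q hpq hp hq => by
    obtain ⟨v, hv⟩ := hf p
    obtain ⟨w, hw⟩ := hf q
    -- Two distinct parts give two vertices, so `secondEigenvalue` is not its default value.
    have hV : 1 < Fintype.card V := Fintype.one_lt_card_iff.mpr
      ⟨v, w, fun h => hpq (by rw [← hv, ← hw, h])⟩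
    refine hG.mul_le_edgeWeight_sq hab hV hlam ?_ (hvol p hp) (hvol q hq) hp hq
    rw [Finset.disjoint_left]
    intro u hu hu'
    rw [mem_filter_univ] at hu hu'
    exact hpq (hu.symm.trans hu')
  rw [sum_sub_distrib, G.sum_boundary_fiber f, sum_const, card_univ, nsmul_eq_mul] at hsum
  rw [Nat.card_eq_fintype_card]
  have : (k : ℝ) * Fintype.card P ≤
      ((G ⊓ (⊤ : SimpleGraph P).comap f).edgeSet.ncard : ℝ) + k := by linarith
  exact_mod_cast this
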